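/- For $n\ge 1$ let $B_n$ be the group of signed permutations $\sigma=\sigma_1\cdots\sigma_n$ of $\{1,\dots,n\}$ (that is, $\sigma_i\in\{\pm1,\dots,\pm n\}$ and $|\sigma_1|\cdots|\sigma_n|$ is a permutation of $\{1,\dots,n\}$), identified with the bijections $\sigma$ of $\{\pm1,\dots,\pm n\}$ satisfying $\sigma(-i)=-\sigma(i)$. Let $\ell_B$ be the Coxeter length on $B_n$ with respect to the generators $s_0=(1,-1)$ and $s_i$ ($1\le i\le n-1$), where $s_i$ exchanges $i$ and $i+1$ (and $-i$ and $-(i+1)$); thus $\ell_B(\sigma)$ is the least $k$ such that $\sigma$ is a product of $k$ generators. Let $\mathcal{D}^{AB}_n$ be the set of $\sigma\in B_n$ with $\sigma_i\ne i$ for all $1\le i\le n$ and with $\ell_B(\sigma)$ even. Let $$\mathrm{fmaj}(\sigma)=2\sum_{\substack{1\le i\le n-1\\ \sigma_{i+1}\prec\sigma_i}} i\;+\;\#\{i\in\{1,\dots,n\}:\sigma_i<0\},$$ where $\prec$ is the order $-1\prec-2\prec\cdots\prec-n\prec0\prec1\prec2\prec\cdots\prec n$. Write $[m]_q=1+q+\cdots+q^{m-1}$.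 Then, for every $n\ge1$, as an identity of rational functions in the indeterminate $q$ over $\mathbb{Q}$, $$\sum_{\sigma\in\mathcal{D}^{AB}_n}q^{\mathrm{fmaj}(\sigma)}=[2]_q[4]_q\cdots[2n]_q\sum_{k=0}^{n}\frac{(-1)^kq^{2\binom{k}{2}}}{[2]_q[4]_q\cdots[2k]_q}\left(\frac12+\frac12\left(\frac{1-q}{1+q}\right)^{\left\lfloor\frac{n-k+1}{2}\right\rfloor}\right),$$ where the products $[2]_q[4]_q\cdots[2k]_q$ run over the even $q$-integers and equal $1$ for $k=0$. -/

import Mathlib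

open Equiv

namespace SignedPermutation

/-- The hyperoctahedral group `B_n`: the permutations `w` of `ℤ` with `w (-i) = -w i` that fix every
`i` with `|i| > n`. Such a `w` is the same as a bijection of `{-n, …, -1, 1, …, n}` with
`w (-i) = -w i` (oddness forces `w 0 = 0`), and hence as the signed word `w 1, w 2, …, w n`. -/
def hyperoctahedralGroup (n : ℕ) : Subgroup (Perm ℤ) where
  carrier := {w | (∀ i : ℤ, w (-i) = -w i) ∧ ∀ i : ℤ, (n : ℤ) < |i| → w i = i}
  one_mem' := ⟨fun _ => rfl, fun _ _ => rfl⟩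
  mul_mem' := by
    rintro a b ⟨ha, ha'⟩ ⟨hb, hb'⟩
    refine ⟨fun i => ?_, fun i hi => ?_⟩
    · rw [Perm.mul_apply, Perm.mul_apply, hb, ha]
    · rw [Perm.mul_apply, hb' i hi, ha' i hi]
  inv_mem' := by
    rintro a ⟨ha, ha'⟩
    refine ⟨fun i => ?_, fun i hi => ?_⟩
    · rw [Perm.inv_eq_iff_eq, ha, show a (a⁻¹ i) = i from a.apply_symm_apply i]
    · rw [Perm.inv_eq_iff_eq, ha' i hi]

instance finite_hyperoctahedralGroup (n : ℕ) : Finite (hyperoctahedralGroup n) := by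
  have hfin : Finite {i : ℤ // i ∈ Set.Icc (-(n : ℤ)) n} :=
    (Set.finite_Icc (-(n : ℤ)) n).to_subtype
  have : Finite {f : Perm ℤ // ∀ a, ¬ a ∈ Set.Icc (-(n : ℤ)) n → f a = a} :=
    Finite.of_equiv _ (Perm.subtypeEquivSubtypePerm (fun i : ℤ => i ∈ Set.Icc (-(n : ℤ)) n))
  refine Finite.of_injective
    (fun w : hyperoctahedralGroup n =>
      (⟨w.1, fun a ha => w.2.2 a ?_⟩ :
        {f : Perm ℤ // ∀ a, ¬ a ∈ Set.Icc (-(n : ℤ)) n → f a = a})) ?_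
  · by_contra h
    exact ha (abs_le.mp (not_lt.mp h))
  · intro a b h
    exact Subtype.ext (congrArg (fun x => x.1) h)

noncomputable instance fintype_hyperoctahedralGroup (n : ℕ) : Fintype (hyperoctahedralGroup n) :=
  Fintype.ofFinite _

/-- The simple reflections: `s_0 = (1, -1)` is the sign change, and for `i ≥ 1` the reflection `s_i`
exchanges `i` and `i + 1` (and `-i` and `-(i + 1)`). -/
def simpleReflection : ℕ → Perm ℤ
  | 0 => swap 1 (-1)
  | (i + 1) => swap ((i : ℤ) + 1) ((i : ℤ) + 2) * swap (-((i : ℤ) + 1)) (-((i : ℤ) + 2))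

theorem simpleReflection_mem {n i : ℕ} (hi : i < n) :
    simpleReflection i ∈ hyperoctahedralGroup n := by
  rcases i with _ | i
  · refine ⟨fun j => ?_, fun j hj => ?_⟩
    · simp only [simpleReflection, swap_apply_def]
      grind
    · simp only [simpleReflection, swap_apply_def]
      grind
  · refine ⟨fun j => ?_, fun j hj => ?_⟩
    · simp only [simpleReflection, Perm.mul_apply, swap_apply_def]
      grind
    · simp only [simpleReflection, Perm.mul_apply, swap_apply_def]
      grind

/-- The Coxeter generators `s_0, s_1, …, s_{n-1}` of `B_n`. -/
def simpleReflections (n : ℕ) : Set (hyperoctahedralGroup n) :=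
  {s | ∃ i < n, (s : Perm ℤ) = simpleReflection i}

/-- The length `ℓ_B(σ)`: the least `k` such that `σ` is a product of `k` Coxeter generators. -/
noncomputable def length {n : ℕ} (σ : hyperoctahedralGroup n) : ℕ :=
  sInf {k : ℕ | ∃ l : List (hyperoctahedralGroup n),
    l.length = k ∧ (∀ s ∈ l, s ∈ simpleReflections n) ∧ l.prod = σ}

/-- The letter `σ_i` of the signed word of `σ`; it is used for `1 ≤ i ≤ n` only. -/
def letter {n : ℕ} (σ : hyperoctahedralGroup n) (i : ℕ) : ℤ := (σ : Perm ℤ) (i : ℤ)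

/-- The order `-1 ≺ -2 ≺ ⋯ ≺ -n ≺ 0 ≺ 1 ≺ 2 ≺ ⋯ ≺ n`. -/
def Prec (a b : ℤ) : Prop :=
  (a < 0 ∧ 0 ≤ b) ∨ (a < 0 ∧ b < a) ∨ (0 ≤ a ∧ a < b)

open Classical in
/-- The major index of the word `σ_1 ⋯ σ_n` with respect to the order `≺`: the sum of the
`i ∈ {1, …, n - 1}` with `σ_{i+1} ≺ σ_i`. -/
noncomputable def maj {n : ℕ} (σ : hyperoctahedralGroup n) : ℕ :=
  ∑ i ∈ (Finset.Ico 1 n).filter (fun i => Prec (letter σ (i + 1)) (letter σ i)), i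

/-- The number of negative letters. -/
def neg {n : ℕ} (σ : hyperoctahedralGroup n) : ℕ :=
  ((Finset.Icc 1 n).filter (fun i => letter σ i < 0)).card

/-- The flag major index. -/
noncomputable def fmaj {n : ℕ} (σ : hyperoctahedralGroup n) : ℕ := 2 * maj σ + neg σ

/-- Derangements of type `B`: no `i ∈ {1, …, n}` has `σ_i = i`. -/
def IsDerangement {n : ℕ} (σ : hyperoctahedralGroup n) : Prop :=
  ∀ i ∈ Finset.Icc 1 n, letter σ i ≠ (i : ℤ)

open Classical in
/-- The set of derangements of even length in `B_n`. -/
noncomputable def evenDerangements (n : ℕ) : Finset (hyperoctahedralGroup n) :=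
  Finset.univ.filter (fun σ => IsDerangement σ ∧ Even (length σ))

/-- The `q`-integer `[m]_q = 1 + q + ⋯ + q^{m-1}`. -/
def qInt {R : Type*} [CommRing R] (q : R) (m : ℕ) : R := ∑ i ∈ Finset.range m, q ^ i

/-- The product `[2]_q [4]_q ⋯ [2m]_q` of the first `m` even `q`-integers (`1` for `m = 0`). -/
def qEvenFactorial {R : Type*} [CommRing R] (q : R) (m : ℕ) : R :=
  ∏ i ∈ Finset.Icc 1 m, qInt q (2 * i)

end SignedPermutation

namespace SignedPermutation

/-! Since `(1 + (-1)^ℓ)/2` detects even length, it suffices to compute the derangement sum weighted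
by a character `ψ`, either trivial or the sign `(-1)^ℓ`; both are compatible with the inclusions of
`B_n` in `B_{n+1}`.

Over the whole group the weighted sum is a product. The rotation `s_n ⋯ s_0` moves every nonzero
letter one step down, cyclically, in `≺`. Every element of `B_{n+1}` is uniquely `rot^k * w` with
`w` in `B_n` and `k < 2(n+1)`, and each rotation raises `fmaj` by one (`fmaj_rot_pow_mul_incl`). So
passing from `n` to `n+1` multiplies the sum by `∑ (ψ(rot) q)^k` (`flagSum_succ`). This is
`[2n+2]_q`, except that for the sign character and `n+1` odd there is an extra factor `(1-q)/(1+q)`;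
hence the floor in the exponent.

The same sum can be sorted by the set `S` of non-fixed positions. Conjugation by an increasing
relabelling identifies the elements with given `S` with the derangements of `B_{|S|}`; it preserves
`ψ` and the number of negative letters. For descents, a letter next to a fixed point behaves as if
it were above or below all fixed points, according to whether it is an excedance. Summing over `S`
is then a shuffle count, giving a Gaussian binomial in `q^2` (`sum_pow_majSum_shuffleDescent`,
`flagSum_eq_sum_derangementSum`). Gaussian inversion (`eq_sum_of_eq_sum_gauss`) solves for the
derangement sums. -/

theorem hyperoctahedralGroup_mono {m n : ℕ} (h : m ≤ n) :
    hyperoctahedralGroup m ≤ hyperoctahedralGroup n := by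
  rintro w ⟨h1, h2⟩
  exact ⟨h1, fun i hi => h2 i (lt_of_le_of_lt (by exact_mod_cast h) hi)⟩

/-! ### Elementary properties of signed permutations. -/

section Basic

variable {n : ℕ} (σ : hyperoctahedralGroup n)

theorem apply_neg (i : ℤ) : σ.1 (-i) = -σ.1 i := σ.2.1 i

theorem apply_of_lt_abs {i : ℤ} (hi : (n : ℤ) < |i|) : σ.1 i = i := σ.2.2 i hi

theorem apply_zero : σ.1 0 = 0 := by
  have := apply_neg σ 0
  simp only [neg_zero] at this
  lia

theorem apply_eq_zero_iff {i : ℤ} : σ.1 i = 0 ↔ i = 0 := by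
  conv_lhs => rw [← apply_zero σ]
  exact σ.1.injective.eq_iff

theorem abs_apply_le {i : ℤ} (hi : |i| ≤ n) : |σ.1 i| ≤ n := by
  by_contra h
  have h1 := apply_of_lt_abs σ (not_le.mp h)
  rw [σ.1.injective h1] at h
  exact h hi

theorem exists_apply_eq {j : ℤ} (hj : |j| ≤ n) : ∃ i : ℤ, |i| ≤ n ∧ σ.1 i = j :=
  ⟨σ.1⁻¹ j, abs_apply_le σ⁻¹ hj, σ.1.apply_symm_apply j⟩

end Basic

/-! ### The rotation and its effect on the flag major index. -/

/-- The product `s_{n-1} ⋯ s_1 s_0`, a cyclic rotation of `±1, …, ±n`. -/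
def rotation : ℕ → Perm ℤ
  | 0 => 1
  | (n + 1) => simpleReflection n * rotation n

theorem rotation_mem (n : ℕ) : rotation n ∈ hyperoctahedralGroup n := by
  induction n with
  | zero => exact one_mem _
  | succ n ih =>
    exact mul_mem (simpleReflection_mem n.lt_succ_self)
      (hyperoctahedralGroup_mono n.le_succ ih)

theorem rotation_apply (n : ℕ) (i : ℤ) : rotation n i =
    if (n : ℤ) < |i| ∨ i = 0 then i else if i = 1 then -n else if i = -1 then n
      else if 0 < i then i - 1 else i + 1 := by
  induction n with
  | zero => simp [rotation]
  | succ n ih =>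
    rw [rotation, Perm.mul_apply, ih]
    rcases n with _ | n
    · simp only [simpleReflection, swap_apply_def]
      grind
    · simp only [simpleReflection, Perm.mul_apply, swap_apply_def]
      push_cast
      grind

/-- The orbit of `n` runs down the order `≺`: `n, …, 1, -n, …, -1`, so every nonzero value occurs
exactly once. -/
theorem rotation_pow_apply {n : ℕ} (k : ℕ) (hk : k < 2 * n) :
    (rotation n ^ k) (n : ℤ) = if k < n then (n : ℤ) - k else (k : ℤ) - 2 * n := by
  induction k with
  | zero => simp; lia
  | succ k ih =>
    rw [pow_succ', Perm.mul_apply, ih (by lia), rotation_apply]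
    push_cast
    grind

theorem fmaj_eq_sum {n : ℕ} (σ : hyperoctahedralGroup n) [DecidableRel Prec] :
    fmaj σ = 2 * (∑ i ∈ Finset.Ico 1 n, if Prec (σ.1 (i + 1)) (σ.1 i) then i else 0) +
      ∑ i ∈ Finset.Icc 1 n, if σ.1 i < 0 then 1 else 0 := by
  rw [fmaj, maj, neg, Finset.sum_filter, Finset.card_filter]
  simp only [letter]
  push_cast
  congr!

theorem fmaj_inclusion {n : ℕ} (σ : hyperoctahedralGroup n) :
    fmaj (Subgroup.inclusion (hyperoctahedralGroup_mono n.le_succ) σ) = fmaj σ := by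
  classical
  rw [fmaj_eq_sum, fmaj_eq_sum]
  simp only [Subgroup.coe_inclusion]
  have h0 : σ.1 ((n : ℤ) + 1) = n + 1 := apply_of_lt_abs σ (by grind)
  rw [Finset.sum_Icc_succ_top (by lia)]
  push_cast
  rw [h0, if_neg (by lia)]
  rcases n.eq_zero_or_pos with rfl | hn
  · simp
  · rw [Finset.sum_Ico_succ_top hn, h0, if_neg]
    · simp
    · have := abs_apply_le σ (i := n) (by simp)
      unfold Prec
      grind

theorem sum_add_eq_sum_add {s : Finset ℕ} {f g a b : ℕ → ℕ} {A B : ℕ} (hA : ∑ i ∈ s, a i = A)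
    (hB : ∑ i ∈ s, b i = B) (h : ∀ i ∈ s, f i + a i = g i + b i) :
    ∑ i ∈ s, f i + A = ∑ i ∈ s, g i + B := by
  rw [← hA, ← hB, ← Finset.sum_add_distrib, ← Finset.sum_add_distrib]
  exact Finset.sum_congr rfl h

/-- If the letter `1` occurs, all comparisons survive and `1` becomes `-n`: one more negative
letter. If `-1` occurs, at place `p < n`, the `≺`-least letter becomes the greatest: the descent at
`p - 1` moves to `p`, so `maj` gains `1` while one negative letter is lost, and `2 - 1 = 1`. -/
theorem fmaj_rotation_mul {n : ℕ} (σ : hyperoctahedralGroup n) (hn : 1 ≤ n)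
    (h : σ.1 n ≠ -1) : fmaj (⟨rotation n, rotation_mem n⟩ * σ) = fmaj σ + 1 := by
  classical
  rw [fmaj_eq_sum, fmaj_eq_sum]
  simp only [Subgroup.coe_mul, Perm.mul_apply, rotation_apply]
  have hle : ∀ i : ℕ, i ≤ n → |σ.1 i| ≤ n := fun i hi => abs_apply_le σ (by grind)
  have hz : ∀ i : ℕ, 1 ≤ i → σ.1 i ≠ 0 := fun i hi => by
    rw [Ne, apply_eq_zero_iff]; lia
  obtain ⟨p, hp1, hpn, hp⟩ : ∃ p : ℕ, 1 ≤ p ∧ p ≤ n ∧ (σ.1 p = 1 ∨ σ.1 p = -1) := by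
    obtain ⟨i, hi, hi1⟩ := exists_apply_eq σ (j := 1) (by rw [abs_one]; exact_mod_cast hn)
    have hi0 : i ≠ 0 := by rintro rfl; rw [apply_zero] at hi1; lia
    rw [abs_le] at hi
    rcases lt_or_gt_of_ne hi0 with h0 | h0
    · refine ⟨i.natAbs, by lia, by lia, Or.inr ?_⟩
      rw [show ((i.natAbs : ℕ) : ℤ) = -i by lia, apply_neg, hi1]
    · refine ⟨i.natAbs, by lia, by lia, Or.inl ?_⟩
      rw [show ((i.natAbs : ℕ) : ℤ) = i by lia, hi1]
  have hinj : ∀ i j : ℕ, σ.1 i = σ.1 j → i = j := fun i j hij => by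
    exact_mod_cast σ.1.injective hij
  have hinj' : ∀ i j : ℕ, 1 ≤ j → σ.1 i ≠ - σ.1 j := fun i j hj hij => by
    rw [← apply_neg] at hij
    have := σ.1.injective hij
    lia
  have hneg : ∀ i : ℕ, 1 ≤ i → i ≠ p → σ.1 i ≠ 1 ∧ σ.1 i ≠ -1 := fun i hi hip => by
    have h1 := hinj i p
    have h2 := hinj' i p hp1
    grind
  have s0 : ∑ i ∈ Finset.Icc 1 n, (if i = p then 1 else 0) = 1 := by
    rw [Finset.sum_ite_eq_of_mem' _ _ _ (by simp; lia)]
  rcases hp with hp | hp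
  · have e1 : ∀ i ∈ Finset.Ico 1 n, (σ.1 (i : ℤ) ≠ -1 ∧ σ.1 ((i : ℤ) + 1) ≠ -1) := by
      intro i hi
      rw [Finset.mem_Ico] at hi
      have h1 := hneg i hi.1
      have h2 := hneg (i + 1) (by lia)
      push_cast at h2
      by_cases h3 : i = p <;> by_cases h4 : i + 1 = p
      · lia
      · subst h3; grind
      · subst h4; push_cast at hp; grind
      · grind
    have m : ∀ i ∈ Finset.Ico 1 n, |σ.1 (i : ℤ)| ≤ n ∧ |σ.1 ((i : ℤ) + 1)| ≤ n ∧
        σ.1 (i : ℤ) ≠ 0 ∧ σ.1 ((i : ℤ) + 1) ≠ 0 := by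
      intro i hi
      rw [Finset.mem_Ico] at hi
      have h1 := hle (i + 1) (by lia)
      have h2 := hz (i + 1) (by lia)
      push_cast at h1 h2
      exact ⟨hle i (by lia), h1, hz i (by lia), h2⟩
    rw [add_assoc]
    congr 1
    · congr 1
      refine Finset.sum_congr rfl fun i hi => ?_
      have h1 := e1 i hi
      have h2 := m i hi
      congr 1
      unfold Prec
      grind
    · refine (sum_add_eq_sum_add (A := 0) (a := fun _ => 0) (by simp) s0 fun i hi => ?_)
      rw [Finset.mem_Icc] at hi
      have h1 := hle i (by lia)
      have h2 := hz i (by lia)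
      have h3 := hneg i hi.1
      grind
  · have hpn' : p < n := by
      rcases hpn.lt_or_eq with h' | rfl
      · exact h'
      · exact absurd hp h
    have key : ∀ a b c d : ℕ, a + (p - 1) = b + p → c + 1 = d →
      2 * a + c = 2 * b + d + 1 := by lia
    refine key _ _ _ _ ?_ ?_
    · have s1 : ∑ i ∈ Finset.Ico 1 n, (if i = p then p else 0) = p := by
        rw [Finset.sum_ite_eq_of_mem' _ _ _ (by simp; lia)]
      -- For `p = 1` there is no descent to remove, and the value `p - 1 = 0` agrees with the empty
      -- contribution.
      have s2 : ∑ i ∈ Finset.Ico 1 n, (if i = p - 1 then p - 1 else 0) = p - 1 := by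
        rw [Finset.sum_ite_eq']
        split_ifs with h'
        · rfl
        · simp at h'; lia
      refine sum_add_eq_sum_add s2 s1 fun i hi => ?_
      rw [Finset.mem_Ico] at hi
      have h1 := hle (i + 1) (by lia)
      have h2 := hz (i + 1) (by lia)
      have h3 := hneg i hi.1
      have h4 := hneg (i + 1) (by lia)
      have h5 := hle i (by lia)
      have h6 := hz i (by lia)
      have h7 : i + 1 = p → σ.1 ((i : ℤ) + 1) = -1 := by rintro rfl; exact_mod_cast hp
      have h8 : i = p → σ.1 (i : ℤ) = -1 := by rintro rfl; exact hp
      push_cast at h1 h2 h4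
      generalize σ.1 ((i : ℤ) + 1) = u at *
      generalize σ.1 (i : ℤ) = v at *
      unfold Prec
      by_cases c1 : i = p
      · have := h8 c1; have := h4 (by lia); grind
      · by_cases c2 : i + 1 = p
        · have := h7 c2; have := h3 (by lia); grind
        · have := h3 c1; have := h4 c2; grind
    · refine (sum_add_eq_sum_add (B := 0) (b := fun _ => 0) s0 (by simp) fun i hi => ?_)
      rw [Finset.mem_Icc] at hi
      have h1 := hle i (by lia)
      have h2 := hz i (by lia)
      have h3 := hneg i hi.1
      grind

/-! ### Coset decomposition and the product formula. -/

/-- The inclusion of `B_n` in `B_{n+1}`. -/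
def incl (n : ℕ) : hyperoctahedralGroup n →* hyperoctahedralGroup (n + 1) :=
  Subgroup.inclusion (hyperoctahedralGroup_mono n.le_succ)

theorem coe_incl {n : ℕ} (σ : hyperoctahedralGroup n) : (incl n σ).1 = σ.1 := rfl

/-- The rotation as an element of `B_n`. -/
def rot (n : ℕ) : hyperoctahedralGroup n := ⟨rotation n, rotation_mem n⟩

theorem rot_succ (n : ℕ) :
    rot (n + 1) = ⟨simpleReflection n, simpleReflection_mem n.lt_succ_self⟩ * incl n (rot n) := rfl

theorem rot_pow_apply {n : ℕ} (k : ℕ) (hk : k < 2 * n) :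
    (rot n ^ k).1 (n : ℤ) = if k < n then (n : ℤ) - k else (k : ℤ) - 2 * n := by
  rw [Subgroup.coe_pow]
  exact rotation_pow_apply k hk

theorem mem_of_mem_succ {n : ℕ} (σ : hyperoctahedralGroup (n + 1))
    (h : σ.1 (n + 1) = n + 1) : σ.1 ∈ hyperoctahedralGroup n := by
  refine ⟨apply_neg σ, fun i hi => ?_⟩
  by_cases h1 : ((n + 1 : ℕ) : ℤ) < |i|
  · exact apply_of_lt_abs σ h1
  · push_cast at h1
    have h2 : i = n + 1 ∨ i = -(n + 1) := by grind
    rcases h2 with rfl | rfl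
    · exact h
    · rw [apply_neg, h]

/-- The image of `n + 1` determines the exponent, because the right factor fixes `n + 1` and the
rotation powers take it once to each nonzero value. Removing that power leaves an element fixing `n
+ 1`, hence one of `B_n`. -/
theorem bijOn_rot_pow_mul_incl (n : ℕ) : Set.BijOn
    (fun x : ℕ × hyperoctahedralGroup n => rot (n + 1) ^ x.1 * incl n x.2)
    (Finset.range (2 * (n + 1)) ×ˢ (Finset.univ : Finset (hyperoctahedralGroup n)) :
      Finset (ℕ × hyperoctahedralGroup n)) Set.univ := by
  have hfix (k : ℕ) (σ : hyperoctahedralGroup n) :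
      (rot (n + 1) ^ k * incl n σ).1 ((n + 1 : ℕ) : ℤ) = (rot (n + 1) ^ k).1 ((n + 1 : ℕ) : ℤ) := by
    rw [Subgroup.coe_mul, Perm.mul_apply, coe_incl, apply_of_lt_abs σ (by push_cast; grind)]
  refine ⟨fun _ _ => Set.mem_univ _, ?_, ?_⟩
  · rintro ⟨k, σ⟩ hk ⟨l, τ⟩ hl h
    simp only [Finset.coe_product, Set.mem_prod, Finset.coe_range, Set.mem_Iio] at hk hl
    have h1 := congrArg (fun x => x.1 ((n + 1 : ℕ) : ℤ)) h
    simp only at h h1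
    rw [hfix, hfix, rot_pow_apply k hk.1, rot_pow_apply l hl.1] at h1
    have hkl : k = l := by grind
    subst hkl
    have h2 := mul_left_cancel h
    rw [Subgroup.inclusion_injective (hyperoctahedralGroup_mono n.le_succ) h2]
  · intro σ _
    have hle := abs_apply_le σ (i := ((n + 1 : ℕ) : ℤ)) (Nat.abs_cast _).le
    have hz : σ.1 ((n + 1 : ℕ) : ℤ) ≠ 0 := by rw [Ne, apply_eq_zero_iff]; lia
    obtain ⟨k, hk, hk1⟩ : ∃ k < 2 * (n + 1),
        (rot (n + 1) ^ k).1 ((n + 1 : ℕ) : ℤ) = σ.1 ((n + 1 : ℕ) : ℤ) := by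
      generalize σ.1 ((n + 1 : ℕ) : ℤ) = v at *
      rw [abs_le] at hle
      rcases lt_or_gt_of_ne hz with h0 | h0
      · refine ⟨(v + 2 * (n + 1)).toNat, by lia, ?_⟩
        rw [rot_pow_apply _ (by lia)]
        grind
      · refine ⟨(n + 1 - v).toNat, by lia, ?_⟩
        rw [rot_pow_apply _ (by lia)]
        grind
    have hmem : ((rot (n + 1) ^ k)⁻¹ * σ).1 ∈ hyperoctahedralGroup n := by
      refine mem_of_mem_succ _ ?_
      have : (((n + 1 : ℕ) : ℤ)) = n + 1 := by push_cast; rfl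
      rw [← this, Subgroup.coe_mul, Perm.mul_apply, ← hk1]
      exact (rot (n + 1) ^ k).1.symm_apply_apply _
    refine ⟨(k, ⟨_, hmem⟩), by simpa using hk, ?_⟩
    simp only
    have : incl n ⟨_, hmem⟩ = (rot (n + 1) ^ k)⁻¹ * σ := rfl
    rw [this, mul_inv_cancel_left]

theorem fmaj_rot_pow_mul_incl {n : ℕ} (σ : hyperoctahedralGroup n) (k : ℕ)
    (hk : k < 2 * (n + 1)) : fmaj (rot (n + 1) ^ k * incl n σ) = fmaj σ + k := by
  induction k with
  | zero => rw [pow_zero, one_mul]; exact fmaj_inclusion σ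
  | succ k ih =>
    rw [pow_succ', mul_assoc]
    -- The last letter reaches `-1` only at exponent `2n + 1`, the largest one allowed, so no
    -- rotation is applied after that.
    refine (fmaj_rotation_mul _ (by lia) ?_).trans (by rw [ih (by lia), add_assoc])
    rw [Subgroup.coe_mul, Perm.mul_apply, coe_incl, apply_of_lt_abs σ (by push_cast; grind),
      rot_pow_apply k (by lia)]
    push_cast
    grind

/-- The generating function of the flag major index on `B_n`, weighted by a sign character. -/
noncomputable def flagSum {R : Type*} [CommRing R] (ψ : ∀ n, hyperoctahedralGroup n →* ℤˣ) (q : R)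
    (n : ℕ) : R := ∑ σ : hyperoctahedralGroup n, ((ψ n σ : ℤ) : R) * q ^ fmaj σ

section

variable {R : Type*} [CommRing R] (ψ : ∀ n, hyperoctahedralGroup n →* ℤˣ) (q : R)

theorem flagSum_zero : flagSum ψ q 0 = 1 := by
  have : ∀ σ : hyperoctahedralGroup 0, σ = 1 := fun σ => by
    refine Subtype.ext (Equiv.ext fun i => ?_)
    rcases eq_or_ne i 0 with rfl | h
    · exact apply_zero σ
    · exact apply_of_lt_abs σ (by simpa using h)
  rw [flagSum, Finset.sum_eq_single_of_mem 1 (Finset.mem_univ _) fun σ _ h => absurd (this σ) h]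
  simp [fmaj, maj, neg]

theorem flagSum_succ (hψ : ∀ n σ, ψ (n + 1) (incl n σ) = ψ n σ) (n : ℕ) :
    flagSum ψ q (n + 1) = flagSum ψ q n *
      ∑ k ∈ Finset.range (2 * (n + 1)), (((ψ (n + 1) (rot (n + 1)) : ℤ) : R) * q) ^ k := by
  have hb := bijOn_rot_pow_mul_incl n
  rw [mul_comm, flagSum, flagSum, Finset.sum_mul_sum, ← Finset.sum_product', eq_comm]
  refine Finset.sum_nbij _ (fun _ _ => Finset.mem_univ _) hb.injOn
    (by rw [Finset.coe_univ]; exact hb.surjOn) ?_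
  rintro ⟨k, σ⟩ hk
  rw [Finset.mem_product, Finset.mem_range] at hk
  simp only
  rw [fmaj_rot_pow_mul_incl σ k hk.1, map_mul, hψ, map_pow]
  push_cast
  ring

end

/-! ### Generation by simple reflections and the sign character. -/

theorem rot_mem_closure (n : ℕ) : rot n ∈ Submonoid.closure (simpleReflections n) ∧
    ∀ w ∈ Submonoid.closure (simpleReflections n),
      incl n w ∈ Submonoid.closure (simpleReflections (n + 1)) := by
  have h : ∀ n, ∀ w ∈ Submonoid.closure (simpleReflections n),
      incl n w ∈ Submonoid.closure (simpleReflections (n + 1)) := fun n w hw => by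
    have h1 : incl n w ∈ (Submonoid.closure (simpleReflections n)).map (incl n) :=
      Submonoid.mem_map_of_mem _ hw
    rw [MonoidHom.map_mclosure] at h1
    refine Submonoid.closure_mono ?_ h1
    rintro _ ⟨s, ⟨i, hi, hs⟩, rfl⟩
    exact ⟨i, by lia, hs⟩
  refine ⟨?_, h n⟩
  induction n with
  | zero => exact one_mem _
  | succ n ih =>
    have hs : (⟨simpleReflection n, simpleReflection_mem n.lt_succ_self⟩ :
        hyperoctahedralGroup (n + 1)) ∈ simpleReflections (n + 1) := ⟨n, n.lt_succ_self, rfl⟩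
    exact mul_mem (Submonoid.subset_closure hs) (h n _ ih)

/-- This makes the set defining `length` nonempty, so that its infimum is attained, and lets
characters be compared on generators. -/
theorem closure_simpleReflections (n : ℕ) : Submonoid.closure (simpleReflections n) = ⊤ := by
  refine eq_top_iff.mpr fun σ _ => ?_
  induction n with
  | zero =>
    have : σ = 1 := by
      refine Subtype.ext (Equiv.ext fun i => ?_)
      rcases eq_or_ne i 0 with rfl | h
      · exact apply_zero σ
      · exact apply_of_lt_abs σ (by simpa using h)
    rw [this]
    exact one_mem _
  | succ n ih =>
    obtain ⟨⟨k, w⟩, -, rfl⟩ := (bijOn_rot_pow_mul_incl n).surjOn (Set.mem_univ σ)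
    exact mul_mem (pow_mem (rot_mem_closure _).1 k) ((rot_mem_closure n).2 w (ih w trivial))

/-- The action of `B_n` on `{-n, …, n}`. -/
def boundedPerm (n : ℕ) : hyperoctahedralGroup n →* Perm {i : ℤ // i ∈ Set.Icc (-(n : ℤ)) n} where
  toFun σ := σ.1.subtypePerm fun i => by
    rw [Set.mem_Icc, Set.mem_Icc, ← abs_le, ← abs_le]
    refine ⟨fun h => ?_, abs_apply_le σ⟩
    simpa using abs_apply_le σ⁻¹ h
  map_one' := rfl
  map_mul' _ _ := rfl

theorem natAbs_apply_natAbs {n : ℕ} (σ : hyperoctahedralGroup n) (i : ℤ) :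
    (σ.1 i.natAbs).natAbs = (σ.1 i).natAbs := by
  rcases Int.natAbs_eq i with h | h
  · rw [← h]
  · conv_rhs => rw [h, apply_neg, Int.natAbs_neg]

theorem natAbs_apply_lt {n : ℕ} (σ : hyperoctahedralGroup n) (i : Fin (n + 1)) :
    (σ.1 (i : ℕ)).natAbs < n + 1 := by
  have := abs_apply_le σ (i := (i : ℕ)) (by grind)
  rw [abs_le] at this
  lia

/-- The action of `B_n` on absolute values. -/
def absPerm (n : ℕ) : hyperoctahedralGroup n →* Perm (Fin (n + 1)) where
  toFun σ :=
    { toFun := fun i => ⟨(σ.1 (i : ℕ)).natAbs, natAbs_apply_lt σ i⟩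
      invFun := fun i => ⟨(σ⁻¹.1 (i : ℕ)).natAbs, natAbs_apply_lt σ⁻¹ i⟩
      left_inv := fun i => by
        ext
        simp only [natAbs_apply_natAbs]
        simp
      right_inv := fun i => by
        ext
        simp only [natAbs_apply_natAbs]
        simp }
  map_one' := by ext; simp
  map_mul' σ τ := by
    ext i
    exact (natAbs_apply_natAbs σ (τ.1 (i : ℕ))).symm

/-- The sign character of `B_n`, which takes the value `-1` on every simple reflection. -/
noncomputable def signChar (n : ℕ) : hyperoctahedralGroup n →* ℤˣ :=
  (Perm.sign.comp (boundedPerm n)) * (Perm.sign.comp (absPerm n))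

/-- `s_0` is one transposition of signed values and trivial on absolute values; every other `s_i` is
two transpositions of signed values and one of absolute values. The total is odd in both cases. -/
theorem signChar_simpleReflection {n : ℕ} {s : hyperoctahedralGroup n}
    (hs : s ∈ simpleReflections n) : signChar n s = -1 := by
  obtain ⟨i, hi, hs⟩ := hs
  simp only [signChar, MonoidHom.mul_apply, MonoidHom.comp_apply]
  rcases i with _ | i
  · have h1 : boundedPerm n s = swap ⟨1, by simp; lia⟩ ⟨-1, by simp; lia⟩ := by
      ext ⟨j, hj⟩
      change s.1 j = _
      rw [hs, simpleReflection, swap_apply_def, swap_apply_def]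
      simp only [Subtype.mk.injEq]
      split_ifs <;> rfl
    have h2 : absPerm n s = 1 := by
      ext j
      change (s.1 (j : ℕ)).natAbs = j
      rw [hs, simpleReflection, swap_apply_def]
      grind
    rw [h1, h2, Perm.sign_swap (by simp)]
    simp
  · have h1 : boundedPerm n s = swap ⟨i + 1, by simp; lia⟩ ⟨i + 2, by simp; lia⟩ *
        swap ⟨-(i + 1), by simp; lia⟩ ⟨-(i + 2), by simp; lia⟩ := by
      ext ⟨j, hj⟩
      change s.1 j = _
      rw [hs, simpleReflection, Perm.mul_apply, Perm.mul_apply]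
      simp only [swap_apply_def, Subtype.mk.injEq]
      split_ifs <;> grind
    have h2 : absPerm n s = swap ⟨i + 1, by lia⟩ ⟨i + 2, by lia⟩ := by
      ext j
      change (s.1 (j : ℕ)).natAbs = _
      rw [hs, simpleReflection, Perm.mul_apply]
      simp only [swap_apply_def, Fin.ext_iff]
      split_ifs <;> grind
    rw [h1, h2, map_mul, Perm.sign_swap (by simp), Perm.sign_swap (by simp),
      Perm.sign_swap (by simp)]
    simp

theorem signChar_incl (n : ℕ) (σ : hyperoctahedralGroup n) :
    signChar (n + 1) (incl n σ) = signChar n σ := by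
  have : (signChar (n + 1)).comp (incl n) = signChar n := by
    refine MonoidHom.eq_of_eqOn_denseM (closure_simpleReflections n) fun s hs => ?_
    rw [signChar_simpleReflection hs, MonoidHom.comp_apply, signChar_simpleReflection]
    obtain ⟨i, hi, hs⟩ := hs
    exact ⟨i, by lia, hs⟩
  exact DFunLike.congr_fun this σ

theorem signChar_rot (n : ℕ) : signChar n (rot n) = (-1) ^ n := by
  induction n with
  | zero => exact map_one _
  | succ n ih =>
    rw [rot_succ, map_mul, signChar_incl, ih, signChar_simpleReflection ⟨n, n.lt_succ_self, rfl⟩,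
      pow_succ']

theorem signChar_eq_neg_one_pow_length {n : ℕ} (σ : hyperoctahedralGroup n) :
    signChar n σ = (-1) ^ length σ := by
  have hne : {k : ℕ | ∃ l : List (hyperoctahedralGroup n),
      l.length = k ∧ (∀ s ∈ l, s ∈ simpleReflections n) ∧ l.prod = σ}.Nonempty := by
    obtain ⟨l, hl, hp⟩ := Submonoid.exists_list_of_mem_closure
      (show σ ∈ Submonoid.closure (simpleReflections n) by
        rw [closure_simpleReflections]; trivial)
    exact ⟨_, l, rfl, hl, hp⟩
  obtain ⟨l, hl, hs, hp⟩ := Nat.sInf_mem hne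
  rw [length, ← hl, ← hp, map_list_prod,
    List.prod_eq_pow_card (l.map (signChar n)) (-1), List.length_map]
  intro x hx
  obtain ⟨s, hs', rfl⟩ := List.mem_map.mp hx
  exact signChar_simpleReflection (hs s hs')

/-! ### Closed forms over the whole group. -/

theorem flagSum_one {R : Type*} [CommRing R] (q : R) (n : ℕ) :
    flagSum (fun _ => 1) q n = qEvenFactorial q n := by
  induction n with
  | zero => simp [flagSum_zero, qEvenFactorial]
  | succ n ih =>
    rw [flagSum_succ _ _ (fun _ _ => rfl), ih, qEvenFactorial, qEvenFactorial,
      Finset.prod_Icc_succ_top (by lia)]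
    simp [qInt]

/-- The rotation of `B_{n+1}` is a product of `n + 1` generators, so its sign is `-1` exactly for
`n` even; then the new factor is `[2n+2]` at `-q`, which is `[2n+2]_q (1-q)/(1+q)`. -/
theorem flagSum_signChar {K : Type*} [Field K] (q : K) (hq : 1 + q ≠ 0) (n : ℕ) :
    flagSum signChar q n = qEvenFactorial q n * ((1 - q) / (1 + q)) ^ ((n + 1) / 2) := by
  induction n with
  | zero => simp [flagSum_zero, qEvenFactorial]
  | succ n ih =>
    rw [flagSum_succ _ _ signChar_incl, ih, qEvenFactorial, qEvenFactorial,
      Finset.prod_Icc_succ_top (by lia), signChar_rot]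
    rcases n.even_or_odd with hn | hn
    · have h1 : ∑ k ∈ Finset.range (2 * (n + 1)), (-q) ^ k =
          qInt q (2 * (n + 1)) * ((1 - q) / (1 + q)) := by
        have e1 := mul_geom_sum (-q) (2 * (n + 1))
        have e2 := mul_geom_sum q (2 * (n + 1))
        rw [Even.neg_pow (even_two_mul _)] at e1
        rw [qInt]
        field_simp
        linear_combination -e1 + e2
      have h2 : (n + 1 + 1) / 2 = (n + 1) / 2 + 1 := by grind
      rw [h2, pow_succ (_ / _), Odd.neg_one_pow hn.add_one]
      push_cast
      rw [neg_one_mul, h1]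
      ring
    · have h2 : (n + 1 + 1) / 2 = (n + 1) / 2 := by grind
      rw [h2, Even.neg_one_pow hn.add_one]
      push_cast
      rw [one_mul, ← qInt]
      ring

/-! ### Major index over shuffles with an increasing word. -/

section Shuffle

variable {K : Type*} [Field K] {p : K} {c F : ℕ → K}

/-- The Gaussian binomial coefficient `(k + f choose k)` computed from a sequence of factorials. -/
def gauss (F : ℕ → K) (k f : ℕ) : K := F (k + f) / (F k * F f)

theorem gauss_zero_left (hF : ∀ n, F n ≠ 0) (hF0 : F 0 = 1) (f : ℕ) : gauss F 0 f = 1 := by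
  rw [gauss, hF0, one_mul, zero_add, div_self (hF f)]

theorem gauss_zero_right (hF : ∀ n, F n ≠ 0) (hF0 : F 0 = 1) (k : ℕ) : gauss F k 0 = 1 := by
  rw [gauss, hF0, mul_one, add_zero, div_self (hF k)]

/-- The `p`-Pascal rule. The sequence `c` plays the `p`-integers and `F` their factorials; the only
property needed is additivity of `c` twisted by `p`, used to split `c (k + f + 2)`. -/
theorem gauss_succ_succ (hF : ∀ n, F n ≠ 0) (hFs : ∀ n, F (n + 1) = F n * c (n + 1))
    (hc : ∀ a b, c (a + b) = c a + p ^ a * c b) (k f : ℕ) :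
    gauss F (k + 1) (f + 1) = gauss F k (f + 1) + p ^ (k + 1) * gauss F (k + 1) f := by
  have hc0 : ∀ n, c (n + 1) ≠ 0 := fun n h => hF (n + 1) (by rw [hFs, h, mul_zero])
  have h1 := hF k
  have h2 := hF f
  have h3 := hc0 k
  have h4 := hc0 f
  simp only [gauss]
  rw [show k + 1 + (f + 1) = k + f + 1 + 1 by ring, show k + (f + 1) = k + f + 1 by ring,
    show k + 1 + f = k + f + 1 by ring, hFs (k + f + 1), hFs k, hFs f,
    show k + f + 1 + 1 = (k + 1) + (f + 1) by ring, hc (k + 1) (f + 1)]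
  field_simp

theorem gauss_succ_succ' (hF : ∀ n, F n ≠ 0) (hFs : ∀ n, F (n + 1) = F n * c (n + 1))
    (hc : ∀ a b, c (a + b) = c a + p ^ a * c b) (k f : ℕ) :
    gauss F (k + 1) (f + 1) = p ^ (f + 1) * gauss F k (f + 1) + gauss F (k + 1) f := by
  have hcomm : ∀ a b, gauss F a b = gauss F b a := fun a b => by
    rw [gauss, gauss, add_comm, mul_comm]
  rw [hcomm, gauss_succ_succ hF hFs hc, hcomm f, hcomm (f + 1) k, add_comm]

/-- The rank of `i` in `S`. -/
def rank (S : Finset ℕ) (i : ℕ) : ℕ := (S.filter (· ≤ i)).card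

/-- The descents of the word obtained from a word with descents `D` by inserting increasing letters
at the places outside `S`; the letters of the old word that exceed the new ones are those in `E`. -/
def ShuffleDescent (D E : ℕ → Prop) (S : Finset ℕ) (i : ℕ) : Prop :=
  (i ∈ S ∧ i + 1 ∈ S ∧ D (rank S i)) ∨ (i ∈ S ∧ i + 1 ∉ S ∧ E (rank S i)) ∨
    (i ∉ S ∧ i + 1 ∈ S ∧ ¬ E (rank S i + 1))

open Classical in
/-- The sum of the elements of `{1, …, n - 1}` that satisfy `D`. -/
noncomputable def majSum (D : ℕ → Prop) (n : ℕ) : ℕ := ∑ i ∈ Finset.Ico 1 n, if D i then i else 0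

open Classical in
theorem majSum_succ (D : ℕ → Prop) (n : ℕ) :
    majSum D (n + 1) = majSum D n + if D n then n else 0 := by
  rcases n with _ | n
  · simp [majSum]
  · rw [majSum, Finset.sum_Ico_succ_top (by lia), majSum]

theorem majSum_congr {D D' : ℕ → Prop} {n : ℕ} (h : ∀ i, 1 ≤ i → i < n → (D i ↔ D' i)) :
    majSum D n = majSum D' n := by
  classical
  refine Finset.sum_congr rfl fun i hi => ?_
  rw [Finset.mem_Ico] at hi
  exact if_congr (h i hi.1 hi.2) rfl rfl

theorem sum_powersetCard_Icc_succ (g : Finset ℕ → K) (n k : ℕ) :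
    ∑ S ∈ (Finset.Icc 1 (n + 1)).powersetCard (k + 1), g S =
      ∑ S ∈ (Finset.Icc 1 n).powersetCard (k + 1), g S +
      ∑ S ∈ (Finset.Icc 1 n).powersetCard k, g (insert (n + 1) S) := by
  have hn : n + 1 ∉ Finset.Icc 1 n := by simp
  rw [← Finset.insert_Icc_right_eq_Icc_add_one (by lia), Finset.powersetCard_succ_insert hn,
    Finset.sum_union, Finset.sum_image]
  · intro S hS T hT h
    rw [Finset.mem_coe, Finset.mem_powersetCard] at hS hT
    rw [← Finset.erase_insert fun h => hn (hS.1 h), ← Finset.erase_insert fun h => hn (hT.1 h), h]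
  · rw [Finset.disjoint_left]
    intro S hS hS'
    rw [Finset.mem_image] at hS'
    obtain ⟨T, -, rfl⟩ := hS'
    exact hn ((Finset.mem_powersetCard.mp hS).1 (Finset.mem_insert_self _ _))

variable (D E : ℕ → Prop)

theorem rank_eq_card {n i : ℕ} {S : Finset ℕ} (hS : S ⊆ Finset.Icc 1 n) (hi : n ≤ i) :
    rank S i = S.card := by
  rw [rank, Finset.filter_true_of_mem]
  intro j hj
  exact (Finset.mem_Icc.mp (hS hj)).2.trans hi

theorem rank_insert {n i : ℕ} {S : Finset ℕ} (hi : i ≤ n) : rank (insert (n + 1) S) i = rank S i := by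
  rw [rank, rank, Finset.filter_insert, if_neg (by lia)]

open Classical in
theorem majSum_shuffleDescent_insert {n : ℕ} {S : Finset ℕ} (hS : S ⊆ Finset.Icc 1 n) :
    majSum (ShuffleDescent D E (insert (n + 1) S)) (n + 1) = majSum (ShuffleDescent D E S) n +
      if n ∈ S then (if D S.card then n else 0) else (if E (S.card + 1) then 0 else n) := by
  rw [majSum_succ]
  congr 1
  · refine majSum_congr fun i _ hi => ?_
    rw [ShuffleDescent, rank_insert hi.le]
    simp only [Finset.mem_insert]
    rw [ShuffleDescent]
    grind
  · rw [ShuffleDescent, rank_insert le_rfl, rank_eq_card hS le_rfl]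
    simp only [Finset.mem_insert]
    grind

open Classical in
theorem majSum_shuffleDescent_succ {n : ℕ} {S : Finset ℕ} (hS : S ⊆ Finset.Icc 1 n) :
    majSum (ShuffleDescent D E S) (n + 1) = majSum (ShuffleDescent D E S) n +
      if n ∈ S then (if E S.card then n else 0) else 0 := by
  rw [majSum_succ]
  congr 1
  rw [ShuffleDescent, rank_eq_card hS le_rfl]
  have : n + 1 ∉ S := fun h => by simpa using hS h
  grind

open Classical in
/-- The generating function of the shuffles whose last letter is an old one. -/
noncomputable def oldLast (p : K) (n k : ℕ) : K := ∑ S ∈ (Finset.Icc 1 n).powersetCard k,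
  if n ∈ S then p ^ majSum (ShuffleDescent D E S) n else 0

open Classical in
/-- The generating function of the shuffles whose last letter is a new one. -/
noncomputable def newLast (p : K) (n k : ℕ) : K := ∑ S ∈ (Finset.Icc 1 n).powersetCard k,
  if n ∈ S then 0 else p ^ majSum (ShuffleDescent D E S) n

theorem oldLast_eq_zero (n : ℕ) : oldLast D E p n 0 = 0 := by
  simp [oldLast]

open Classical in
theorem oldLast_succ (n k : ℕ) : oldLast D E p (n + 1) (k + 1) =
    p ^ (if D k then n else 0) * oldLast D E p n k +
      p ^ (if E (k + 1) then 0 else n) * newLast D E p n k := by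
  rw [oldLast, sum_powersetCard_Icc_succ, Finset.sum_eq_zero, zero_add, oldLast, newLast,
    Finset.mul_sum, Finset.mul_sum, ← Finset.sum_add_distrib]
  · refine Finset.sum_congr rfl fun S hS => ?_
    rw [Finset.mem_powersetCard] at hS
    rw [if_pos (Finset.mem_insert_self _ _), majSum_shuffleDescent_insert D E hS.1, hS.2, pow_add]
    split_ifs <;> ring
  · intro S hS
    rw [Finset.mem_powersetCard] at hS
    rw [if_neg fun h => by simpa using hS.1 h]

open Classical in
theorem newLast_succ (n k : ℕ) : newLast D E p (n + 1) k =
    p ^ (if E k then n else 0) * oldLast D E p n k + newLast D E p n k := by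
  have h : ∑ S ∈ (Finset.Icc 1 n).powersetCard k,
      (if n + 1 ∈ S then 0 else p ^ majSum (ShuffleDescent D E S) (n + 1)) =
      p ^ (if E k then n else 0) * oldLast D E p n k + newLast D E p n k := by
    rw [oldLast, newLast, Finset.mul_sum, ← Finset.sum_add_distrib]
    refine Finset.sum_congr rfl fun S hS => ?_
    rw [Finset.mem_powersetCard] at hS
    rw [if_neg fun h => by simpa using hS.1 h, majSum_shuffleDescent_succ D E hS.1, hS.2, pow_add]
    split_ifs <;> ring
  rw [← h, newLast]
  rcases k with _ | k
  · simp
  · rw [sum_powersetCard_Icc_succ, add_eq_left]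
    exact Finset.sum_eq_zero fun S _ => if_pos (Finset.mem_insert_self _ _)

open Classical in
/-- The closed form of `oldLast`. -/
noncomputable def oldForm (F : ℕ → K) (p : K) : ℕ → ℕ → K
  | 0, _ => 0
  | k + 1, f => p ^ majSum D (k + 1) * (if E (k + 1) then 1 else p ^ f) * gauss F k f

open Classical in
/-- The closed form of `newLast`. -/
noncomputable def newForm (F : ℕ → K) (p : K) : ℕ → ℕ → K
  | 0, 0 => 1
  | _ + 1, 0 => 0
  | k, f + 1 => p ^ majSum D k * (if E k then p ^ k else 1) * gauss F k f

theorem newForm_zero (hF : ∀ n, F n ≠ 0) (hF0 : F 0 = 1) (f : ℕ) : newForm D E F p 0 f = 1 := by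
  rcases f with _ | f
  · rfl
  · simp [newForm, gauss_zero_left hF hF0, majSum]

theorem oldForm_add_newForm (hF : ∀ n, F n ≠ 0) (hF0 : F 0 = 1)
    (hFs : ∀ n, F (n + 1) = F n * c (n + 1)) (hc : ∀ a b, c (a + b) = c a + p ^ a * c b)
    (k f : ℕ) : oldForm D E F p k f + newForm D E F p k f = p ^ majSum D k * gauss F k f := by
  rcases k with _ | k
  · rw [newForm_zero D E hF hF0, gauss_zero_left hF hF0]
    simp [oldForm, majSum]
  · rcases f with _ | f
    · simp [oldForm, newForm, gauss_zero_right hF hF0]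
    · have h1 := gauss_succ_succ hF hFs hc k f
      have h2 := gauss_succ_succ' hF hFs hc k f
      simp only [oldForm, newForm, Nat.succ_eq_add_one]
      split_ifs
      · rw [h1]; ring
      · rw [h2]; ring

-- Appending an old letter. The closed forms satisfy the recursion only if consecutive old letters
-- on opposite sides of the new ones compare accordingly, which is what `h1` and `h2` say; when both
-- lie on the same side, `D k` is free.
open Classical in
theorem oldForm_succ (hF : ∀ n, F n ≠ 0) (hF0 : F 0 = 1)
    (hFs : ∀ n, F (n + 1) = F n * c (n + 1)) (hc : ∀ a b, c (a + b) = c a + p ^ a * c b)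
    (k f : ℕ) (h1 : 1 ≤ k → E k → ¬ E (k + 1) → D k) (h2 : 1 ≤ k → ¬ E k → E (k + 1) → ¬ D k) :
    oldForm D E F p (k + 1) f = p ^ (if D k then k + f else 0) * oldForm D E F p k f +
      p ^ (if E (k + 1) then 0 else k + f) * newForm D E F p k f := by
  rcases k with _ | k
  · rw [newForm_zero D E hF hF0]
    simp only [oldForm, gauss_zero_left hF hF0]
    simp only [majSum]
    split_ifs <;> simp
  · rcases f with _ | f
    · simp only [oldForm, newForm, gauss_zero_right hF hF0]
      rw [majSum_succ D (k + 1)]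
      split_ifs <;> ring
    · have e1 := gauss_succ_succ hF hFs hc k f
      have e2 := gauss_succ_succ' hF hFs hc k f
      simp only [oldForm, newForm, Nat.succ_eq_add_one]
      rw [majSum_succ D (k + 1)]
      by_cases hE : E (k + 1) <;> by_cases hE' : E (k + 1 + 1) <;> by_cases hD : D (k + 1)
      · simp only [hE, hE', hD, if_true]; rw [e2]; ring
      · simp only [hE, hE', hD, if_true, if_false]; rw [e1]; ring
      · simp only [hE, hE', hD, if_true, if_false]; rw [e1]; ring
      · exact absurd (h1 (by lia) hE hE') hD
      · exact absurd hD (h2 (by lia) hE hE')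
      · simp only [hE, hE', hD, if_true, if_false]; rw [e2]; ring
      · simp only [hE, hE', hD, if_true, if_false]; rw [e2]; ring
      · simp only [hE, hE', hD, if_false]; rw [e1]; ring

open Classical in
theorem newForm_succ (hF : ∀ n, F n ≠ 0) (hF0 : F 0 = 1)
    (hFs : ∀ n, F (n + 1) = F n * c (n + 1)) (hc : ∀ a b, c (a + b) = c a + p ^ a * c b)
    (k f : ℕ) : newForm D E F p k (f + 1) =
      p ^ (if E k then k + f else 0) * oldForm D E F p k f + newForm D E F p k f := by
  rcases k with _ | k
  · rw [newForm_zero D E hF hF0, newForm_zero D E hF hF0]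
    simp [oldForm]
  · rcases f with _ | f
    · simp only [oldForm, newForm, Nat.succ_eq_add_one, gauss_zero_right hF hF0]
      split_ifs <;> ring
    · have e1 := gauss_succ_succ hF hFs hc k f
      have e2 := gauss_succ_succ' hF hFs hc k f
      simp only [oldForm, newForm, Nat.succ_eq_add_one]
      split_ifs
      · rw [e2]; ring
      · rw [e2]; ring

theorem oldLast_newLast_eq (hF : ∀ n, F n ≠ 0) (hF0 : F 0 = 1)
    (hFs : ∀ n, F (n + 1) = F n * c (n + 1)) (hc : ∀ a b, c (a + b) = c a + p ^ a * c b) {N : ℕ}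
    (h1 : ∀ k, 1 ≤ k → k < N → E k → ¬ E (k + 1) → D k)
    (h2 : ∀ k, 1 ≤ k → k < N → ¬ E k → E (k + 1) → ¬ D k) (n k f : ℕ) (hn : k + f = n)
    (hk : k ≤ N) : oldLast D E p n k = oldForm D E F p k f ∧
      newLast D E p n k = newForm D E F p k f := by
  induction n generalizing k f with
  | zero =>
    -- The empty word is counted by `newLast`, since `0 ∉ ∅`; this is why `newForm` is `1` at `(0,
    -- 0)`.
    obtain ⟨rfl, rfl⟩ : k = 0 ∧ f = 0 := by lia
    simp [oldLast, newLast, oldForm, newForm, majSum, Finset.filter_singleton]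
  | succ n ih =>
    constructor
    · rcases k with _ | k
      · rw [oldLast_eq_zero]; rfl
      · obtain ⟨i1, i2⟩ := ih k f (by lia) (by lia)
        obtain rfl : k + f = n := by lia
        rw [oldLast_succ, oldForm_succ D E hF hF0 hFs hc k f (fun h => h1 k h hk)
          (fun h => h2 k h hk), i1, i2]
    · rcases f with _ | f
      · obtain rfl : k = n + 1 := by lia
        have : (Finset.Icc 1 n).powersetCard (n + 1) = ∅ :=
          Finset.powersetCard_eq_empty.mpr (by simp)
        rw [newLast_succ, oldLast, newLast, this]
        simp [newForm]
      · obtain ⟨i1, i2⟩ := ih k f (by lia) hk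
        obtain rfl : k + f = n := by lia
        rw [newLast_succ, newForm_succ D E hF hF0 hFs hc, i1, i2]

/-- The generating function of the major index over the shuffles of a word of length `k` with an
increasing word of length `f`, every letter of the former being below or above all of the latter. -/
theorem sum_pow_majSum_shuffleDescent (hF : ∀ n, F n ≠ 0) (hF0 : F 0 = 1)
    (hFs : ∀ n, F (n + 1) = F n * c (n + 1)) (hc : ∀ a b, c (a + b) = c a + p ^ a * c b) {k : ℕ}
    (h1 : ∀ i, 1 ≤ i → i < k → E i → ¬ E (i + 1) → D i)
    (h2 : ∀ i, 1 ≤ i → i < k → ¬ E i → E (i + 1) → ¬ D i) (f : ℕ) :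
    ∑ S ∈ (Finset.Icc 1 (k + f)).powersetCard k, p ^ majSum (ShuffleDescent D E S) (k + f) =
      p ^ majSum D k * gauss F k f := by
  obtain ⟨e1, e2⟩ := oldLast_newLast_eq D E hF hF0 hFs hc h1 h2 (k + f) k f rfl le_rfl
  rw [← oldForm_add_newForm D E hF hF0 hFs hc, ← e1, ← e2, oldLast, newLast,
    ← Finset.sum_add_distrib]
  refine Finset.sum_congr rfl fun S _ => ?_
  split_ifs <;> simp

end Shuffle

/-! ### Ranks and the increasing relabelling. -/

theorem one_le_rank {S : Finset ℕ} {i : ℕ} (hi : i ∈ S) : 1 ≤ rank S i :=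
  Finset.card_pos.mpr ⟨i, by simp [hi]⟩

theorem rank_le_card (S : Finset ℕ) (i : ℕ) : rank S i ≤ S.card := Finset.card_filter_le _ _

theorem rank_succ {S : Finset ℕ} {i : ℕ} (hi : i + 1 ∈ S) : rank S (i + 1) = rank S i + 1 := by
  have : S.filter (· ≤ i + 1) = insert (i + 1) (S.filter (· ≤ i)) := by
    ext j
    simp only [Finset.mem_filter, Finset.mem_insert]
    grind
  rw [rank, this, Finset.card_insert_of_notMem (by simp), rank]

theorem rank_lt_rank {S : Finset ℕ} {i j : ℕ} (hj : j ∈ S) (h : i < j) : rank S i < rank S j := by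
  obtain ⟨j, rfl⟩ := Nat.exists_eq_add_of_lt h
  rw [rank_succ hj, Nat.lt_succ_iff]
  exact Finset.card_le_card (Finset.monotone_filter_right _ fun a ha => by grind)

theorem rank_lt_rank_iff {S : Finset ℕ} {i j : ℕ} (hi : i ∈ S) (hj : j ∈ S) :
    rank S i < rank S j ↔ i < j := by
  refine ⟨fun h => ?_, rank_lt_rank hj⟩
  by_contra h'
  rcases (not_lt.mp h').lt_or_eq with h1 | rfl
  · exact absurd (rank_lt_rank hi h1) (by lia)
  · exact lt_irrefl _ h

theorem exists_rank_eq {S : Finset ℕ} {r : ℕ} (h1 : 1 ≤ r) (h2 : r ≤ S.card) :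
    ∃ i ∈ S, rank S i = r := by
  have hinj : Set.InjOn (rank S) S := by
    intro i hi j hj h
    have h1 := rank_lt_rank_iff hi hj
    have h2 := rank_lt_rank_iff hj hi
    lia
  have : S.image (rank S) = Finset.Icc 1 S.card := by
    refine Finset.eq_of_subset_of_card_le ?_ ?_
    · intro r hr
      obtain ⟨i, hi, rfl⟩ := Finset.mem_image.mp hr
      exact Finset.mem_Icc.mpr ⟨one_le_rank hi, rank_le_card S i⟩
    · rw [Finset.card_image_of_injOn hinj, Nat.card_Icc, Nat.add_sub_cancel]
  have hr : r ∈ S.image (rank S) := by rw [this]; exact Finset.mem_Icc.mpr ⟨h1, h2⟩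
  exact Finset.mem_image.mp hr

theorem signed_swap_mem {n a b : ℕ} (ha : 1 ≤ a) (hb : 1 ≤ b) (han : a ≤ n) (hbn : b ≤ n) :
    swap (a : ℤ) b * swap (-(a : ℤ)) (-b) ∈ hyperoctahedralGroup n := by
  refine ⟨fun j => ?_, fun j hj => ?_⟩
  · simp only [Perm.mul_apply, swap_apply_def]
    grind
  · simp only [Perm.mul_apply, swap_apply_def]
    grind

/-- A signed permutation carries `1, 2, …, |S|` onto `S` increasingly. -/
theorem exists_unshuffle {n : ℕ} {S : Finset ℕ} (hS : S ⊆ Finset.Icc 1 n) :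
    ∃ π : hyperoctahedralGroup n, ∀ i ∈ S, π.1 (rank S i) = i := by
  induction n generalizing S with
  | zero => exact ⟨1, fun i hi => by simpa using hS hi⟩
  | succ n ih =>
    by_cases hn : n + 1 ∈ S
    · have hS' : S.erase (n + 1) ⊆ Finset.Icc 1 n := fun i hi => by
        have := hS (Finset.mem_of_mem_erase hi)
        have := Finset.ne_of_mem_erase hi
        simp only [Finset.mem_Icc] at *
        lia
      obtain ⟨π, hπ⟩ := ih hS'
      have hk : S.card ≤ n + 1 := by simpa using Finset.card_le_card hS
      have hk1 : 1 ≤ S.card := Finset.card_pos.mpr ⟨_, hn⟩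
      -- The swap sends the top rank `|S|` to `n + 1`, which `π` fixes, and leaves the smaller ranks
      -- to `π`. Values beyond `|S|` are irrelevant, as only conjugates of elements of `B_{|S|}`
      -- will be used.
      refine ⟨incl n π * ⟨_, signed_swap_mem hk1 n.succ_pos hk le_rfl⟩, fun i hi => ?_⟩
      rw [Subgroup.coe_mul, Perm.mul_apply, coe_incl]
      by_cases hin : i = n + 1
      · subst hin
        rw [rank_eq_card hS le_rfl]
        have : (swap (S.card : ℤ) (n + 1 : ℕ) * swap (-(S.card : ℤ)) (-(n + 1 : ℕ))) S.card =
            (n + 1 : ℕ) := by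
          simp only [Perm.mul_apply, swap_apply_def]
          grind
        refine (congrArg π.1 this).trans ?_
        exact apply_of_lt_abs π (by push_cast; grind)
      · have hi' : i ∈ S.erase (n + 1) := Finset.mem_erase.mpr ⟨hin, hi⟩
        have hin' := Finset.mem_Icc.mp (hS hi)
        have hr : rank S i = rank (S.erase (n + 1)) i := by
          conv_lhs => rw [← Finset.insert_erase hn, rank_insert (by lia)]
        have hlt : rank S i < S.card := by
          rw [hr, ← Finset.card_erase_add_one hn, Nat.lt_succ_iff]
          exact rank_le_card _ _
        have : (swap (S.card : ℤ) (n + 1 : ℕ) * swap (-(S.card : ℤ)) (-(n + 1 : ℕ))) (rank S i) =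
            rank S i := by
          simp only [Perm.mul_apply, swap_apply_def]
          grind
        refine (congrArg π.1 this).trans ?_
        rw [hr]
        exact hπ i hi'
    · have hS' : S ⊆ Finset.Icc 1 n := fun i hi => by
        have := hS hi
        have : i ≠ n + 1 := fun h => hn (h ▸ hi)
        simp only [Finset.mem_Icc] at *
        lia
      obtain ⟨π, hπ⟩ := ih hS'
      exact ⟨incl n π, hπ⟩

/-! ### Conjugation by the relabelling and its effect on the statistics. -/

section Conjugation

variable {n : ℕ} {S : Finset ℕ} {π : hyperoctahedralGroup n}

theorem exists_mem_apply_eq (hπ : ∀ i ∈ S, π.1 (rank S i) = i) {r : ℤ} (h1 : 1 ≤ r)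
    (h2 : r ≤ S.card) : ∃ i ∈ S, (rank S i : ℤ) = r ∧ π.1 r = i := by
  obtain ⟨i, hi, hr⟩ := exists_rank_eq (S := S) (r := r.toNat) (by lia) (by lia)
  have : (rank S i : ℤ) = r := by lia
  exact ⟨i, hi, this, by rw [← this, hπ i hi]⟩

theorem unshuffle_lt_iff (hπ : ∀ i ∈ S, π.1 (rank S i) = i) {r s : ℤ} (hr : 1 ≤ r)
    (hr' : r ≤ S.card) (hs : 1 ≤ s) (hs' : s ≤ S.card) : π.1 r < π.1 s ↔ r < s := by
  obtain ⟨i, hi, e1, e2⟩ := exists_mem_apply_eq hπ hr hr'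
  obtain ⟨j, hj, e3, e4⟩ := exists_mem_apply_eq hπ hs hs'
  rw [e2, e4, ← e1, ← e3, Nat.cast_lt, Nat.cast_lt, rank_lt_rank_iff hi hj]

theorem unshuffle_pos_iff (hS : S ⊆ Finset.Icc 1 n) (hπ : ∀ i ∈ S, π.1 (rank S i) = i) {r : ℤ}
    (hr : |r| ≤ S.card) : 0 < π.1 r ↔ 0 < r := by
  have hpos : ∀ r : ℤ, 1 ≤ r → r ≤ S.card → 0 < π.1 r := fun r h1 h2 => by
    obtain ⟨i, hi, -, e2⟩ := exists_mem_apply_eq hπ h1 h2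
    have := Finset.mem_Icc.mp (hS hi)
    lia
  rw [abs_le] at hr
  rcases lt_trichotomy r 0 with h | rfl | h
  · have := hpos (-r) (by lia) (by lia)
    rw [apply_neg] at this
    lia
  · rw [apply_zero]
  · have := hpos r (by lia) (by lia)
    lia

/-- On negative letters `≺` compares absolute values, so oddness of `π` reduces this to its
monotonicity on `1, …, |S|`. -/
theorem prec_unshuffle_iff (hS : S ⊆ Finset.Icc 1 n) (hπ : ∀ i ∈ S, π.1 (rank S i) = i) {r s : ℤ}
    (hr : |r| ≤ S.card) (hr0 : r ≠ 0) (hs : |s| ≤ S.card) (hs0 : s ≠ 0) :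
    Prec (π.1 r) (π.1 s) ↔ Prec r s := by
  have p1 := unshuffle_pos_iff hS hπ hr
  have p2 := unshuffle_pos_iff hS hπ hs
  have z1 : π.1 r ≠ 0 := by rwa [Ne, apply_eq_zero_iff]
  have z2 : π.1 s ≠ 0 := by rwa [Ne, apply_eq_zero_iff]
  rw [abs_le] at hr hs
  have l1 : 0 < r → 0 < s → (π.1 r < π.1 s ↔ r < s) := fun h1 h2 =>
    unshuffle_lt_iff hπ (by lia) (by lia) (by lia) (by lia)
  have l2 : r < 0 → s < 0 → (π.1 (-r) < π.1 (-s) ↔ -r < -s) := fun h1 h2 =>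
    unshuffle_lt_iff hπ (by lia) (by lia) (by lia) (by lia)
  rw [apply_neg, apply_neg] at l2
  unfold Prec
  grind

theorem hyperoctahedralGroup_card_le (hS : S ⊆ Finset.Icc 1 n) :
    hyperoctahedralGroup S.card ≤ hyperoctahedralGroup n :=
  hyperoctahedralGroup_mono (by simpa using Finset.card_le_card hS)

/-- The signed permutation of `S` obtained from `δ` by the increasing relabelling, with fixed points
outside `S`. -/
def relabel (hS : S ⊆ Finset.Icc 1 n) (π : hyperoctahedralGroup n)
    (δ : hyperoctahedralGroup S.card) : hyperoctahedralGroup n :=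
  π * Subgroup.inclusion (hyperoctahedralGroup_card_le hS) δ * π⁻¹

theorem relabel_apply (hS : S ⊆ Finset.Icc 1 n) (δ : hyperoctahedralGroup S.card) (r : ℤ) :
    (relabel hS π δ).1 (π.1 r) = π.1 (δ.1 r) := by
  simp [relabel]

theorem relabel_apply_of_mem (hS : S ⊆ Finset.Icc 1 n) (hπ : ∀ i ∈ S, π.1 (rank S i) = i)
    (δ : hyperoctahedralGroup S.card) {i : ℕ} (hi : i ∈ S) :
    (relabel hS π δ).1 i = π.1 (δ.1 (rank S i)) := by
  rw [← relabel_apply hS, hπ i hi]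

theorem lt_abs_of_apply_eq (hS : S ⊆ Finset.Icc 1 n) (hπ : ∀ i ∈ S, π.1 (rank S i) = i) {i : ℕ}
    (hi1 : 1 ≤ i) (hi : i ∉ S) {r : ℤ} (hr : π.1 r = i) : (S.card : ℤ) < |r| := by
  by_contra h
  have hp := (unshuffle_pos_iff hS hπ (not_lt.mp h)).mp (by lia)
  rw [abs_of_pos hp, not_lt] at h
  obtain ⟨j, hj, -, e⟩ := exists_mem_apply_eq hπ hp h
  rw [hr, Nat.cast_inj] at e
  exact hi (e ▸ hj)

theorem relabel_apply_of_notMem (hS : S ⊆ Finset.Icc 1 n) (hπ : ∀ i ∈ S, π.1 (rank S i) = i)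
    (δ : hyperoctahedralGroup S.card) {i : ℕ} (hi1 : 1 ≤ i) (hi : i ∉ S) :
    (relabel hS π δ).1 i = i := by
  have hr : π.1 (π.1⁻¹ i) = i := π.1.apply_symm_apply i
  conv_lhs => rw [← hr]
  rw [relabel_apply, apply_of_lt_abs δ (lt_abs_of_apply_eq hS hπ hi1 hi hr), hr]

theorem neg_relabel (hS : S ⊆ Finset.Icc 1 n) (hπ : ∀ i ∈ S, π.1 (rank S i) = i)
    (δ : hyperoctahedralGroup S.card) : neg (relabel hS π δ) = neg δ := by
  have hneg : ∀ i ∈ S, ((relabel hS π δ).1 i < 0 ↔ δ.1 (rank S i) < 0) := fun i hi => by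
    have h1 := one_le_rank hi
    have h2 := rank_le_card S i
    have h3 := unshuffle_pos_iff hS hπ (abs_apply_le δ (i := rank S i) (by grind))
    have h4 : δ.1 (rank S i) ≠ 0 := by rw [Ne, apply_eq_zero_iff]; lia
    have h5 : π.1 (δ.1 (rank S i)) ≠ 0 := by rwa [Ne, apply_eq_zero_iff]
    rw [relabel_apply_of_mem hS hπ δ hi]
    lia
  have hmem : ∀ i : ℕ, 1 ≤ i → (relabel hS π δ).1 i < 0 → i ∈ S := fun i h1 h2 => by
    by_contra h
    rw [relabel_apply_of_notMem hS hπ δ h1 h] at h2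
    lia
  rw [neg, neg]
  refine Finset.card_bij (fun i _ => rank S i) ?_ ?_ ?_
  · intro i hi
    rw [Finset.mem_filter, Finset.mem_Icc] at hi ⊢
    have hiS := hmem i hi.1.1 hi.2
    exact ⟨⟨one_le_rank hiS, rank_le_card S i⟩, (hneg i hiS).mp hi.2⟩
  · intro i hi j hj h
    rw [Finset.mem_filter, Finset.mem_Icc] at hi hj
    have hiS := hmem i hi.1.1 hi.2
    have hjS := hmem j hj.1.1 hj.2
    have h1 := rank_lt_rank_iff hiS hjS
    have h2 := rank_lt_rank_iff hjS hiS
    lia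
  · intro r hr
    rw [Finset.mem_filter, Finset.mem_Icc] at hr
    obtain ⟨i, hi, rfl⟩ := exists_rank_eq hr.1.1 hr.1.2
    refine ⟨i, ?_, rfl⟩
    rw [Finset.mem_filter]
    exact ⟨hS hi, (hneg i hi).mpr hr.2⟩

theorem maj_eq_majSum {n : ℕ} (σ : hyperoctahedralGroup n) :
    maj σ = majSum (fun i => Prec (σ.1 (i + 1)) (σ.1 i)) n := by
  rw [maj, majSum, Finset.sum_filter]
  rfl

/-- Relabelling preserves `≺` and excedances. A moved letter is never equal to its own position nor
to an adjacent fixed point, so comparing it with that fixed point amounts to asking whether it is an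
excedance. Two adjacent fixed points never form a descent. -/
theorem maj_relabel (hS : S ⊆ Finset.Icc 1 n) (hπ : ∀ i ∈ S, π.1 (rank S i) = i)
    {δ : hyperoctahedralGroup S.card} (hδ : IsDerangement δ) :
    maj (relabel hS π δ) = majSum (ShuffleDescent (fun i => Prec (δ.1 (i + 1)) (δ.1 i))
      (fun i => (i : ℤ) < δ.1 i) S) n := by
  rw [maj_eq_majSum]
  refine majSum_congr fun i hi1 hin => ?_
  have hmem : ∀ j ∈ S, (1 : ℤ) ≤ rank S j ∧ (rank S j : ℤ) ≤ S.card ∧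
      |δ.1 (rank S j)| ≤ S.card ∧ δ.1 (rank S j) ≠ 0 ∧ δ.1 (rank S j) ≠ rank S j := fun j hj => by
    have h1 := one_le_rank hj
    have h2 := rank_le_card S j
    refine ⟨by lia, by lia, abs_apply_le δ (by grind), ?_, ?_⟩
    · rw [Ne, apply_eq_zero_iff]; lia
    · exact hδ _ (Finset.mem_Icc.mpr ⟨h1, h2⟩)
  have hlt : ∀ j ∈ S, (j : ℤ) ≠ π.1 (δ.1 (rank S j)) ∧
      ((j : ℤ) < π.1 (δ.1 (rank S j)) ↔ (rank S j : ℤ) < δ.1 (rank S j)) := fun j hj => by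
    obtain ⟨h1, h2, h3, h4, h5⟩ := hmem j hj
    have h6 := hπ j hj
    refine ⟨fun h => h5 (π.1.injective (by rw [h6, ← h])), ?_⟩
    rcases lt_or_gt_of_ne h4 with h0 | h0
    · have := unshuffle_pos_iff hS hπ h3
      lia
    · rw [← unshuffle_lt_iff hπ h1 h2 h0 (abs_le.mp h3).2, h6]
  rw [ShuffleDescent]
  by_cases c1 : i ∈ S <;> by_cases c2 : i + 1 ∈ S
  · have e1 := relabel_apply_of_mem hS hπ δ c1
    have e2 := relabel_apply_of_mem hS hπ δ c2
    obtain ⟨-, -, a1, a2, -⟩ := hmem i c1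
    obtain ⟨-, -, a3, a4, -⟩ := hmem _ c2
    rw [← Nat.cast_succ, Nat.succ_eq_add_one, e1, e2, prec_unshuffle_iff hS hπ a3 a4 a1 a2,
      rank_succ c2]
    simp [c1, c2]
  · have e1 := relabel_apply_of_mem hS hπ δ c1
    have e2 := relabel_apply_of_notMem hS hπ δ (by lia) c2
    have h1 := (hlt i c1).2
    -- Excluding the value `i + 1` turns the comparison with the fixed point `i + 1` into the
    -- comparison with `i`.
    have h2 : π.1 (δ.1 (rank S i)) ≠ ((i + 1 : ℕ) : ℤ) := fun h => by
      have h3 := lt_abs_of_apply_eq hS hπ (by lia) c2 h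
      exact absurd (hmem i c1).2.2.1 (not_le.mpr h3)
    rw [← Nat.cast_succ, Nat.succ_eq_add_one, e1, e2]
    simp only [c1, c2, true_and, not_true, not_false_eq_true, false_and, or_false, false_or]
    rw [← h1]
    unfold Prec
    grind
  · have e1 := relabel_apply_of_notMem hS hπ δ (by lia) c1
    have e2 := relabel_apply_of_mem hS hπ δ c2
    have h1 := (hlt _ c2)
    have h2 : π.1 (δ.1 (rank S (i + 1))) ≠ (i : ℤ) := fun h => by
      have h3 := lt_abs_of_apply_eq hS hπ (by lia) c1 h
      exact absurd (hmem _ c2).2.2.1 (not_le.mpr h3)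
    rw [← Nat.cast_succ, Nat.succ_eq_add_one, e1, e2]
    simp only [c1, c2, true_and, not_false_eq_true, false_and, false_or]
    rw [← rank_succ c2, ← h1.2]
    unfold Prec
    grind
  · have e1 := relabel_apply_of_notMem hS hπ δ (by lia) c1
    have e2 := relabel_apply_of_notMem hS hπ δ (i := i + 1) (by lia) c2
    rw [← Nat.cast_succ, Nat.succ_eq_add_one, e1, e2]
    simp only [c1, c2, false_and, and_false, false_or, iff_false]
    unfold Prec
    grind

end Conjugation

/-! ### Sorting by the non-fixed positions. -/

/-- The set of `i` in `{1, …, n}` that are not fixed. -/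
def nonfixed {n : ℕ} (σ : hyperoctahedralGroup n) : Finset ℕ :=
  (Finset.Icc 1 n).filter fun i => σ.1 i ≠ i

theorem nonfixed_relabel {n : ℕ} {S : Finset ℕ} {π : hyperoctahedralGroup n}
    (hS : S ⊆ Finset.Icc 1 n) (hπ : ∀ i ∈ S, π.1 (rank S i) = i)
    {δ : hyperoctahedralGroup S.card} (hδ : IsDerangement δ) : nonfixed (relabel hS π δ) = S := by
  ext i
  rw [nonfixed, Finset.mem_filter]
  constructor
  · rintro ⟨h1, h2⟩
    by_contra h
    exact h2 (relabel_apply_of_notMem hS hπ δ (Finset.mem_Icc.mp h1).1 h)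
  · intro h
    refine ⟨hS h, fun h1 => ?_⟩
    rw [relabel_apply_of_mem hS hπ δ h, ← hπ i h] at h1
    refine hδ (rank S i) (Finset.mem_Icc.mpr ⟨one_le_rank h, rank_le_card S i⟩)
      (π.1.injective ?_)
    rw [letter, h1]

theorem exists_relabel_eq {n : ℕ} {S : Finset ℕ} {π : hyperoctahedralGroup n}
    (hS : S ⊆ Finset.Icc 1 n) (hπ : ∀ i ∈ S, π.1 (rank S i) = i) {σ : hyperoctahedralGroup n}
    (hσ : nonfixed σ = S) :
    ∃ δ : hyperoctahedralGroup S.card, IsDerangement δ ∧ relabel hS π δ = σ := by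
  have hmem : (π⁻¹ * σ * π).1 ∈ hyperoctahedralGroup S.card := by
    refine ⟨apply_neg (π⁻¹ * σ * π), fun r hr => ?_⟩
    by_cases hrn : (n : ℤ) < |r|
    · exact apply_of_lt_abs (π⁻¹ * σ * π) hrn
    -- If `|r| > |S|` then `π r` is not `±` an element of `S`, the set `±S` being the image of the
    -- ranks up to sign; so `σ` fixes it.
    have hfix : ∀ j : ℕ, 1 ≤ j → j ≤ n → (π.1 r = j ∨ π.1 r = -j) → σ.1 j = j :=
      fun j h1 hn h => by
        by_contra hj
        have hjS : j ∈ S := by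
          rw [← hσ, nonfixed, Finset.mem_filter, Finset.mem_Icc]
          exact ⟨⟨h1, hn⟩, hj⟩
        have h2 := rank_le_card S j
        rw [← hπ j hjS, ← apply_neg] at h
        rcases h with h | h
        · rw [π.1.injective h, Nat.abs_cast] at hr
          lia
        · rw [π.1.injective h, abs_neg, Nat.abs_cast] at hr
          lia
    have h0 : π.1 r ≠ 0 := by
      rw [Ne, apply_eq_zero_iff]
      rintro rfl
      rw [abs_zero] at hr
      lia
    have hle := abs_apply_le π (not_lt.mp hrn)
    rw [abs_le] at hle
    have hf := hfix (π.1 r).natAbs (by lia) (by lia) (by lia)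
    have : σ.1 (π.1 r) = π.1 r := by
      rcases Int.natAbs_eq (π.1 r) with h | h
      · rw [h]; exact hf
      · rw [h, apply_neg, hf]
    simp only [Subgroup.coe_mul, Perm.mul_apply, this]
    exact π.1.symm_apply_apply r
  refine ⟨⟨_, hmem⟩, fun r hr h => ?_, ?_⟩
  · rw [Finset.mem_Icc] at hr
    obtain ⟨i, hi, rfl⟩ := exists_rank_eq hr.1 hr.2
    have h1 : π.1⁻¹ (σ.1 (π.1 (rank S i))) = rank S i := h
    rw [hπ i hi, Perm.inv_eq_iff_eq, hπ i hi] at h1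
    rw [← hσ, nonfixed, Finset.mem_filter] at hi
    exact hi.2 h1
  · have : Subgroup.inclusion (hyperoctahedralGroup_card_le hS) ⟨_, hmem⟩ = π⁻¹ * σ * π := rfl
    rw [relabel, this]
    group

theorem sign_inclusion {ψ : ∀ n, hyperoctahedralGroup n →* ℤˣ}
    (hψ : ∀ n σ, ψ (n + 1) (incl n σ) = ψ n σ) {k n : ℕ} (h : k ≤ n)
    (σ : hyperoctahedralGroup k) :
    ψ n (Subgroup.inclusion (hyperoctahedralGroup_mono h) σ) = ψ k σ := by
  induction n, h using Nat.le_induction with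
  | base => rfl
  | succ n h ih => exact (hψ n _).trans ih

open Classical in
/-- The generating function of the flag major index on the derangements in `B_n`, weighted by a sign
character. -/
noncomputable def derangementSum {R : Type*} [CommRing R] (ψ : ∀ n, hyperoctahedralGroup n →* ℤˣ)
    (q : R) (n : ℕ) : R :=
  ∑ δ : hyperoctahedralGroup n with IsDerangement δ, ((ψ n δ : ℤ) : R) * q ^ fmaj δ

open Classical in
theorem sum_nonfixed_eq {R : Type*} [CommRing R] {ψ : ∀ n, hyperoctahedralGroup n →* ℤˣ}
    (hψ : ∀ n σ, ψ (n + 1) (incl n σ) = ψ n σ) (q : R) {n k : ℕ} {S : Finset ℕ}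
    (hS : S ⊆ Finset.Icc 1 n) (hk : S.card = k) :
    ∑ σ : hyperoctahedralGroup n with nonfixed σ = S, ((ψ n σ : ℤ) : R) * q ^ fmaj σ =
      ∑ δ : hyperoctahedralGroup k with IsDerangement δ, ((ψ k δ : ℤ) : R) * (q ^ neg δ *
        (q ^ 2) ^ majSum (ShuffleDescent (fun i => Prec (δ.1 (i + 1)) (δ.1 i))
          (fun i => (i : ℤ) < δ.1 i) S) n) := by
  subst hk
  obtain ⟨π, hπ⟩ := exists_unshuffle hS
  symm
  refine Finset.sum_bij (fun δ _ => relabel hS π δ) ?_ ?_ ?_ ?_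
  · intro δ hδ
    rw [Finset.mem_filter] at hδ ⊢
    exact ⟨Finset.mem_univ _, nonfixed_relabel hS hπ hδ.2⟩
  · intro δ _ ε _ h
    exact Subgroup.inclusion_injective _ (mul_left_cancel (mul_right_cancel h))
  · intro σ hσ
    obtain ⟨δ, h1, h2⟩ := exists_relabel_eq hS hπ (Finset.mem_filter.mp hσ).2
    exact ⟨δ, Finset.mem_filter.mpr ⟨Finset.mem_univ _, h1⟩, h2⟩
  · intro δ hδ
    have hd := (Finset.mem_filter.mp hδ).2
    -- `ψ` has commutative values, so the conjugating element cancels.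
    have h1 : ψ n (relabel hS π δ) = ψ S.card δ := by
      rw [relabel, map_mul, map_mul, map_inv, mul_right_comm, mul_inv_cancel, one_mul]
      exact sign_inclusion hψ (by simpa using Finset.card_le_card hS) δ
    rw [h1, fmaj, neg_relabel hS hπ, maj_relabel hS hπ hd, pow_add, pow_mul, mul_comm (q ^ neg δ)]

-- For each derangement `δ`, summing over all `S` of its size is the shuffle identity with `p = q ^
-- 2`, where the old letters above the new ones are the excedances of `δ`.
open Classical in
theorem flagSum_eq_sum_derangementSum {K : Type*} [Field K]
    {ψ : ∀ n, hyperoctahedralGroup n →* ℤˣ} (hψ : ∀ n σ, ψ (n + 1) (incl n σ) = ψ n σ) {q : K}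
    {c F : ℕ → K} (hF : ∀ n, F n ≠ 0) (hF0 : F 0 = 1) (hFs : ∀ n, F (n + 1) = F n * c (n + 1))
    (hc : ∀ a b, c (a + b) = c a + (q ^ 2) ^ a * c b) (n : ℕ) :
    flagSum ψ q n = ∑ k ∈ Finset.range (n + 1), derangementSum ψ q k * gauss F k (n - k) := by
  rw [flagSum, ← Finset.sum_fiberwise_of_maps_to (g := nonfixed)
    (t := (Finset.Icc 1 n).powerset) (fun σ _ => Finset.mem_powerset.mpr (Finset.filter_subset _ _)),
    Finset.sum_powerset, Nat.card_Icc, Nat.add_sub_cancel]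
  refine Finset.sum_congr rfl fun k hk => ?_
  rw [Finset.sum_congr rfl fun S hS => sum_nonfixed_eq hψ q (Finset.mem_powersetCard.mp hS).1
    (Finset.mem_powersetCard.mp hS).2, Finset.sum_comm, derangementSum, Finset.sum_mul]
  refine Finset.sum_congr rfl fun δ hδ => ?_
  have hd := (Finset.mem_filter.mp hδ).2
  have hne : ∀ i : ℕ, 1 ≤ i → i ≤ k → δ.1 (i : ℤ) ≠ i := fun i h1 h2 =>
    hd i (Finset.mem_Icc.mpr ⟨h1, h2⟩)
  obtain ⟨f, rfl⟩ := Nat.exists_eq_add_of_le (Finset.mem_range_succ_iff.mp hk)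
  rw [← Finset.mul_sum, ← Finset.mul_sum, sum_pow_majSum_shuffleDescent _ _ hF hF0 hFs hc,
    Nat.add_sub_cancel_left, fmaj, maj_eq_majSum, pow_add, pow_mul]
  · ring
  -- An excedance followed by a non-excedance: `δ_{i+1} ≤ i < δ_i`, because `i + 1` is not fixed;
  -- hence a descent. The reverse situation below gives an ascent.
  · intro i h1 h2 h3 h4
    have := hne (i + 1) (by lia) (by lia)
    push_cast at h4 this
    unfold Prec
    grind
  · intro i h1 h2 h3 h4
    push_cast at h4
    have := hne i h1 h2.le
    unfold Prec
    grind

/-! ### Gaussian inversion. -/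

section Inversion

variable {K : Type*} [Field K] {p : K} {c F : ℕ → K}

/-- The `p`-Pascal rule makes the alternating sum telescope; at `m = n` the partial sum cancels the
one remaining term of the full sum. -/
theorem sum_range_neg_one_pow_mul_gauss (hF : ∀ n, F n ≠ 0) (hF0 : F 0 = 1)
    (hFs : ∀ n, F (n + 1) = F n * c (n + 1)) (hc : ∀ a b, c (a + b) = c a + p ^ a * c b)
    (n m : ℕ) (hm : m ≤ n) :
    ∑ k ∈ Finset.range (m + 1), (-1) ^ k * p ^ k.choose 2 * gauss F k (n + 1 - k) =
      (-1) ^ m * p ^ (m + 1).choose 2 * gauss F m (n - m) := by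
  induction m with
  | zero => simp [gauss_zero_left hF hF0]
  | succ m ih =>
    obtain ⟨f, rfl⟩ := Nat.exists_eq_add_of_le hm
    rw [Finset.sum_range_succ, ih (by lia), show m + 1 + f + 1 - (m + 1) = f + 1 by lia,
      gauss_succ_succ hF hFs hc, show m + 1 + f - m = f + 1 by lia, Nat.add_sub_cancel_left,
      show (m + 1 + 1).choose 2 = (m + 1) + (m + 1).choose 2 by
        rw [Nat.choose_succ_succ' (m + 1) 1, Nat.choose_one_right]]
    ring

theorem sum_neg_one_pow_mul_gauss (hF : ∀ n, F n ≠ 0) (hF0 : F 0 = 1)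
    (hFs : ∀ n, F (n + 1) = F n * c (n + 1)) (hc : ∀ a b, c (a + b) = c a + p ^ a * c b) (n : ℕ) :
    ∑ k ∈ Finset.range (n + 1 + 1), (-1) ^ k * p ^ k.choose 2 * gauss F k (n + 1 - k) = 0 := by
  rw [Finset.sum_range_succ, sum_range_neg_one_pow_mul_gauss hF hF0 hFs hc n n le_rfl,
    Nat.sub_self, Nat.sub_self, gauss_zero_right hF hF0, gauss_zero_right hF hF0]
  ring

/-- Gaussian inversion. -/
theorem eq_sum_of_eq_sum_gauss (hF : ∀ n, F n ≠ 0) (hF0 : F 0 = 1)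
    (hFs : ∀ n, F (n + 1) = F n * c (n + 1)) (hc : ∀ a b, c (a + b) = c a + p ^ a * c b)
    {d P : ℕ → K} (h : ∀ n, P n = ∑ k ∈ Finset.range (n + 1), d k * gauss F k (n - k)) (n : ℕ) :
    d n = F n * ∑ k ∈ Finset.range (n + 1),
      (-1) ^ k * p ^ k.choose 2 / F k * (P (n - k) / F (n - k)) := by
  -- The two `p`-exponential series are mutually inverse, by the vanishing alternating sum. The
  -- hypothesis `h` is a product with one of them, so multiplying by the other inverts it.
  have h1 : PowerSeries.mk (fun k => (-1) ^ k * p ^ k.choose 2 / F k) *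
      PowerSeries.mk (fun k => 1 / F k) = 1 := by
    ext n
    rw [PowerSeries.coeff_mul, PowerSeries.coeff_one,
      Finset.Nat.sum_antidiagonal_eq_sum_range_succ_mk]
    simp only [PowerSeries.coeff_mk]
    rcases n with _ | n
    · simp [hF0]
    · rw [if_neg n.succ_ne_zero, ← mul_eq_zero_iff_left (hF (n + 1)),
        ← sum_neg_one_pow_mul_gauss hF hF0 hFs hc n, Finset.mul_sum]
      refine Finset.sum_congr rfl fun k hk => ?_
      obtain ⟨f, hf⟩ := Nat.exists_eq_add_of_le (Finset.mem_range_succ_iff.mp hk)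
      rw [hf, Nat.add_sub_cancel_left, gauss]
      field_simp
  have h2 : PowerSeries.mk (fun k => P k / F k) =
      PowerSeries.mk (fun k => d k / F k) * PowerSeries.mk (fun k => 1 / F k) := by
    ext n
    rw [PowerSeries.coeff_mul, Finset.Nat.sum_antidiagonal_eq_sum_range_succ_mk]
    simp only [PowerSeries.coeff_mk]
    rw [h, Finset.sum_div]
    refine Finset.sum_congr rfl fun k hk => ?_
    obtain ⟨f, rfl⟩ := Nat.exists_eq_add_of_le (Finset.mem_range_succ_iff.mp hk)
    have := hF (k + f)
    rw [Nat.add_sub_cancel_left, gauss]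
    field_simp
  have h3 : PowerSeries.mk (fun k => d k / F k) =
      PowerSeries.mk (fun k => (-1) ^ k * p ^ k.choose 2 / F k) *
        PowerSeries.mk (fun k => P k / F k) := by
    rw [h2, mul_left_comm, h1, mul_one]
  have h4 := congrArg (PowerSeries.coeff n) h3
  rw [PowerSeries.coeff_mul, Finset.Nat.sum_antidiagonal_eq_sum_range_succ_mk] at h4
  simp only [PowerSeries.coeff_mk] at h4
  rw [← h4, mul_div_cancel₀ _ (hF n)]

end Inversion

/-! ### Specialisation to even `q`-integers and conclusion. -/

theorem qInt_add {R : Type*} [CommRing R] (q : R) (a b : ℕ) :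
    qInt q (2 * (a + b)) = qInt q (2 * a) + (q ^ 2) ^ a * qInt q (2 * b) := by
  rw [qInt, mul_add, Finset.sum_range_add, qInt, qInt, Finset.mul_sum, ← pow_mul]
  simp only [pow_add]

theorem qEvenFactorial_succ {R : Type*} [CommRing R] (q : R) (n : ℕ) :
    qEvenFactorial q (n + 1) = qEvenFactorial q n * qInt q (2 * (n + 1)) := by
  rw [qEvenFactorial, Finset.prod_Icc_succ_top (by lia), qEvenFactorial]

theorem qInt_X_ne_zero {m : ℕ} (hm : m ≠ 0) : qInt (RatFunc.X : RatFunc ℚ) m ≠ 0 := by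
  have h : qInt (RatFunc.X : RatFunc ℚ) m =
      algebraMap (Polynomial ℚ) (RatFunc ℚ) (qInt Polynomial.X m) := by
    simp [qInt, RatFunc.algebraMap_X]
  rw [h, Ne, FaithfulSMul.algebraMap_eq_zero_iff]
  intro h0
  -- At `q = 1` the `q`-integer takes the value `m`.
  have := congrArg (Polynomial.eval 1) h0
  simp [qInt, Polynomial.eval_finsetSum] at this
  exact hm this

theorem derangementSum_eq {K : Type*} [Field K] {ψ : ∀ n, hyperoctahedralGroup n →* ℤˣ}
    (hψ : ∀ n σ, ψ (n + 1) (incl n σ) = ψ n σ) {q : K} (hq : ∀ m, m ≠ 0 → qInt q m ≠ 0) (n : ℕ) :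
    derangementSum ψ q n = qEvenFactorial q n * ∑ k ∈ Finset.range (n + 1),
      (-1) ^ k * q ^ (2 * k.choose 2) / qEvenFactorial q k *
        (flagSum ψ q (n - k) / qEvenFactorial q (n - k)) := by
  have hF : ∀ n, qEvenFactorial q n ≠ 0 := fun n =>
    Finset.prod_ne_zero_iff.mpr fun i hi => hq _ (by rw [Finset.mem_Icc] at hi; lia)
  have hF0 : qEvenFactorial q 0 = 1 := by simp [qEvenFactorial]
  have hc := fun a b => qInt_add q a b
  simp only [pow_mul]
  exact eq_sum_of_eq_sum_gauss (c := fun n => qInt q (2 * n)) hF hF0 (qEvenFactorial_succ q) hc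
    (flagSum_eq_sum_derangementSum hψ (c := fun n => qInt q (2 * n)) hF hF0
      (qEvenFactorial_succ q) hc) n

theorem sum_evenDerangements {K : Type*} [Field K] [CharZero K] (q : K) (n : ℕ) :
    ∑ σ ∈ evenDerangements n, q ^ fmaj σ =
      1 / 2 * derangementSum (fun _ => 1) q n + 1 / 2 * derangementSum signChar q n := by
  classical
  rw [derangementSum, derangementSum, ← mul_add, ← Finset.sum_add_distrib, Finset.mul_sum,
    evenDerangements, ← Finset.filter_filter, Finset.sum_filter]
  refine Finset.sum_congr (by congr!) fun σ _ => ?_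
  rw [signChar_eq_neg_one_pow_length]
  split_ifs with h
  · rw [h.neg_one_pow]
    simp
    ring
  · rw [(Nat.not_even_iff_odd.mp h).neg_one_pow]
    simp

end SignedPermutation

theorem mainTheorem11 (n : ℕ) (hn : 1 ≤ n) (q : RatFunc ℚ) (hq : q = RatFunc.X) :
    ∑ σ ∈ SignedPermutation.evenDerangements n, q ^ SignedPermutation.fmaj σ =
      SignedPermutation.qEvenFactorial q n *
        ∑ k ∈ Finset.range (n + 1),
          (-1) ^ k * q ^ (2 * k.choose 2) / SignedPermutation.qEvenFactorial q k *
            (1 / 2 + 1 / 2 * ((1 - q) / (1 + q)) ^ ((n - k + 1) / 2)) := by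
  open SignedPermutation in
  have h0 : ∀ m, m ≠ 0 → qInt q m ≠ 0 := fun m hm => hq ▸ qInt_X_ne_zero hm
  have h1 : 1 + q ≠ 0 := by simpa [qInt, Finset.sum_range_succ] using h0 2 two_ne_zero
  have hF : ∀ n, qEvenFactorial q n ≠ 0 := fun n =>
    Finset.prod_ne_zero_iff.mpr fun i hi => h0 _ (by rw [Finset.mem_Icc] at hi; lia)
  rw [sum_evenDerangements, derangementSum_eq (fun _ _ => rfl) h0,
    derangementSum_eq signChar_incl h0, mul_left_comm, mul_left_comm (1 / 2), ← mul_add,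
    Finset.mul_sum, Finset.mul_sum, ← Finset.sum_add_distrib]
  congr 1
  refine Finset.sum_congr rfl fun k _ => ?_
  rw [flagSum_one, flagSum_signChar q h1, div_self (hF _), mul_div_cancel_left₀ _ (hF _)]
  ring
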